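/- Fix $d\ge 4$. A pure state of $\mathbb C^d$ is a rank-one projector $|v\rangle\langle v|$, $\|v\|=1$. A preparation is a finite convex decomposition $\rho=\sum_i p_i|\psi_i\rangle\langle\psi_i|$ into pure states. For preparations $\rho_1,\rho_2$ let the quantum overlap be $\omega_Q(\rho_1,\rho_2)=2\,(1-A_Q(\rho_1,\rho_2))$, where the anti-distinguishability is $$A_Q(\rho_1,\rho_2)=\tfrac12\max_{(M_1,M_2)}\big(\operatorname{Tr}(\rho_1M_2)+\operatorname{Tr}(\rho_2M_1)\big),$$ the maximum being over all two-outcome POVMs. An ontological model of $\mathbb C^d$ consists of a measurable space $\Lambda$, a probability measure $\mu(\cdot|\psi)$ on $\Lambda$ for every pure state $\psi$, and, for every POVM $M=(M_1,\dots,M_r)$ and outcome $k$, a measurable function $\xi(k|M,\cdot)\ge 0$ on $\Lambda$ with $\sum_k\xi(k|M,\lambda)=1$ for all $\lambda$, such that $\int_\Lambda\xi(k|M,\lambda)\,\mu(d\lambda|\psi)=\operatorname{Tr}(|\psi\rangle\langle\psi|M_k)$. A preparation $\rho=\sum_ip_i|\psi_i\rangle\langle\psi_i|$ has the epistemic state $\mu(\cdot|\rho)=\sum_ip_i\,\mu(\cdot|\psi_i)$,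 and the epistemic overlap in the model is $\omega_E(\rho_1,\rho_2)=\int_\Lambda\min(\mu(\lambda|\rho_1),\mu(\lambda|\rho_2))\,d\lambda$, where $\mu(\lambda|\rho_i)$ are densities with respect to any common dominating measure $d\lambda$ (for instance $\mu(\cdot|\rho_1)+\mu(\cdot|\rho_2)$). Theorem. For every $d\ge4$ and every $n\ge1$ there exist $nd+1$ pairwise distinct pure states $\psi_0$ and $\phi_{i|k}$ ($1\le i\le d$, $1\le k\le n$) of $\mathbb C^d$ such that the preparations $\rho_0=|\psi_0\rangle\langle\psi_0|$ and $\rho_k=\frac1d\sum_{i=1}^d|\phi_{i|k}\rangle\langle\phi_{i|k}|$ satisfy $\omega_Q(\rho_0,\rho_k)>0$ for all $k$ and, in every ontological model of $\mathbb C^d$, $$\frac1n\sum_{k=1}^n\frac{\omega_E(\rho_0,\rho_k)}{\omega_Q(\rho_0,\rho_k)}\le 8\,\frac{d^{1/(d-2)}}{n^{(d-3)/(d-2)}}.$$ For every fixed $d\ge 4$ the right-hand side tends to $0$ as $n\to\infty$. -/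

import Mathlib

open scoped ComplexOrder ENNReal
open MeasureTheory

universe u

/-- A pure state of `ℂ^d`: a matrix of the form `|v⟩⟨v|` with `v` a unit vector
(so that vectors which differ by a phase give the same pure state). -/
abbrev PureState (d : ℕ) : Type :=
  {P : Matrix (Fin d) (Fin d) ℂ //
    ∃ v : EuclideanSpace ℂ (Fin d), ‖v‖ = 1 ∧ P = Matrix.of fun i j => v i * star (v j)}

/-- An `n`-outcome measurement (POVM) on `ℂ^d`. -/
structure POVM (d n : ℕ) where
  effect : Fin n → Matrix (Fin d) (Fin d) ℂ
  posSemidef : ∀ k, (effect k).PosSemidef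
  sum_eq_one : ∑ k, effect k = 1

/-- A quantum preparation on `ℂ^d`: a density operator together with one particular
decomposition of it, `∑ i, weight i • |ψ_i⟩⟨ψ_i|`, as a finite convex mixture of pure states. -/
structure Preparation (d : ℕ) where
  size : ℕ
  weight : Fin size → ℝ
  weight_nonneg : ∀ i, 0 ≤ weight i
  sum_weight : ∑ i, weight i = 1
  state : Fin size → PureState d

/-- The density operator of a preparation. -/
noncomputable def Preparation.density {d : ℕ} (ρ : Preparation d) : Matrix (Fin d) (Fin d) ℂ :=
  ∑ i, (ρ.weight i : ℂ) • (ρ.state i).1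

/-- The preparation of a pure state. -/
noncomputable def Preparation.pure {d : ℕ} (ψ : PureState d) : Preparation d where
  size := 1
  weight := fun _ => 1
  weight_nonneg := fun _ => zero_le_one
  sum_weight := by simp
  state := fun _ => ψ

/-- The uniform mixture `(1/m) ∑ i, |φ_i⟩⟨φ_i|` of `m` pure states. -/
noncomputable def Preparation.uniform {d m : ℕ} (hm : 0 < m) (φ : Fin m → PureState d) :
    Preparation d where
  size := m
  weight := fun _ => 1 / (m : ℝ)
  weight_nonneg := fun _ => by positivity
  sum_weight := by
    have : (m : ℝ) ≠ 0 := by positivity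
    simp [this]
  state := φ

/-- Born's rule: the probability of outcome `k` when the measurement `M` is performed on a
system with density operator `ρ`. -/
noncomputable def bornProb {d n : ℕ} (ρ : Matrix (Fin d) (Fin d) ℂ) (M : POVM d n) (k : Fin n) :
    ℝ :=
  (Matrix.trace (ρ * M.effect k)).re

/-- Anti-distinguishability of `n` preparations: the maximum over all `n`-outcome measurements of
the average probability that the outcome differs from the label of the preparation. -/
noncomputable def antiDistinguishability {d n : ℕ} (ρ : Fin n → Preparation d) : ℝ :=
  ⨆ M : POVM d n,
    (1 / (n : ℝ)) * ∑ x, ∑ k ∈ Finset.univ.filter (fun k => k ≠ x), bornProb (ρ x).density M k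

/-- Common quantum overlap of `n` preparations. -/
noncomputable def quantumOverlap {d n : ℕ} (ρ : Fin n → Preparation d) : ℝ :=
  (n : ℝ) * (1 - antiDistinguishability ρ)

/-- Common overlap `∫ min_x f_x` of finitely many measures with densities `f_x`, where the
densities are taken with respect to the sum of the measures. For finite measures any other
measure with respect to which all of them have densities gives the same value, see
`commonOverlap_withDensity`. -/
noncomputable def commonOverlap {Λ : Type*} [MeasurableSpace Λ] {n : ℕ} (μ : Fin n → Measure Λ) :
    ℝ≥0∞ :=
  ∫⁻ l, ⨅ x, (μ x).rnDeriv (Measure.sum μ) l ∂(Measure.sum μ)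

theorem iInf_withDensity_univ {Λ : Type*} [MeasurableSpace Λ] {n : ℕ} (hn : 0 < n)
    (ν : Measure Λ) (f : Fin n → Λ → ℝ≥0∞) (hf : ∀ x, Measurable (f x)) :
    (⨅ x, ν.withDensity (f x)) Set.univ = ∫⁻ l, ⨅ x, f x l ∂ν := by
  classical
  have : Nonempty (Fin n) := ⟨⟨0, hn⟩⟩
  set g : Λ → ℝ≥0∞ := fun l => ⨅ x, f x l with hg
  have hgm : Measurable g := Measurable.iInf hf
  apply le_antisymm
  · set B : Fin n → Set Λ := fun x => {l | f x l = g l} with hB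
    have hBm : ∀ x, MeasurableSet (B x) := fun x => measurableSet_eq_fun (hf x) hgm
    have hcov : (⋃ x, B x) = Set.univ := by
      refine Set.eq_univ_of_forall fun l => ?_
      obtain ⟨x, hx⟩ := exists_eq_ciInf_of_finite (f := fun x => f x l)
      exact Set.mem_iUnion.2 ⟨x, hx⟩
    have hDm : ∀ x, MeasurableSet (disjointed B x) :=
      fun x => by
        rw [disjointed_apply, Finset.sup_set_eq_biUnion]
        exact (hBm x).diff (Finset.measurableSet_biUnion _ fun y _ => hBm y)
    have hdis : Pairwise (Function.onFun Disjoint (disjointed B)) := disjoint_disjointed B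
    have hDc : (⋃ x, disjointed B x) = Set.univ := by rw [iUnion_disjointed, hcov]
    calc (⨅ x, ν.withDensity (f x)) Set.univ
        = ∑' x, (⨅ x, ν.withDensity (f x)) (disjointed B x) := by
          rw [← hDc, measure_iUnion hdis hDm]
      _ ≤ ∑' x, ν.withDensity g (disjointed B x) := by
          refine ENNReal.tsum_le_tsum fun x => ?_
          calc (⨅ x, ν.withDensity (f x)) (disjointed B x)
              ≤ ν.withDensity (f x) (disjointed B x) := iInf_le (fun x => ν.withDensity (f x)) x _
            _ = ν.withDensity g (disjointed B x) := by
              rw [withDensity_apply _ (hDm x), withDensity_apply _ (hDm x)]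
              exact setLIntegral_congr_fun (hDm x) fun l hl => disjointed_subset B x hl
      _ = ν.withDensity g Set.univ := by rw [← measure_iUnion hdis hDm, hDc]
      _ = ∫⁻ l, g l ∂ν := by rw [withDensity_apply _ MeasurableSet.univ, setLIntegral_univ]
  · have h : ν.withDensity g ≤ ⨅ x, ν.withDensity (f x) :=
      le_iInf fun x => withDensity_mono (Filter.Eventually.of_forall fun l => iInf_le _ x)
    calc ∫⁻ l, g l ∂ν = ν.withDensity g Set.univ := by
          rw [withDensity_apply _ MeasurableSet.univ, setLIntegral_univ]
      _ ≤ _ := h _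

theorem commonOverlap_withDensity {Λ : Type*} [MeasurableSpace Λ] {n : ℕ} (hn : 0 < n)
    (ν : Measure Λ) (f : Fin n → Λ → ℝ≥0∞) (hf : ∀ x, Measurable (f x))
    (hfin : ∀ x, IsFiniteMeasure (ν.withDensity (f x))) :
    commonOverlap (fun x => ν.withDensity (f x)) = ∫⁻ l, ⨅ x, f x l ∂ν := by
  set μ : Fin n → Measure Λ := fun x => ν.withDensity (f x) with hμ
  have : ∀ x, IsFiniteMeasure (μ x) := hfin
  have hac : ∀ x, μ x ≪ Measure.sum μ := fun x => (Measure.le_sum μ x).absolutelyContinuous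
  have hrn : ∀ x, (Measure.sum μ).withDensity ((μ x).rnDeriv (Measure.sum μ)) = μ x :=
    fun x => Measure.withDensity_rnDeriv_eq _ _ (hac x)
  change commonOverlap μ = _
  rw [← iInf_withDensity_univ hn ν f hf, commonOverlap,
    ← iInf_withDensity_univ hn _ _ (fun x => Measure.measurable_rnDeriv (μ x) _)]
  simp_rw [hrn]
  rfl

/-- An ontological model of the quantum system `ℂ^d`: an ontic state space `Λ`, an epistemic state
(a probability distribution on `Λ`) for every pure state, and a response scheme for every
measurement, which together reproduce Born's rule. -/
structure OntologicalModel (d : ℕ) where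
  Λ : Type u
  [measurableSpace : MeasurableSpace Λ]
  epistemic : PureState d → Measure Λ
  isProbabilityMeasure : ∀ ψ, IsProbabilityMeasure (epistemic ψ)
  response : ∀ {n : ℕ}, POVM d n → Fin n → Λ → ℝ
  measurable_response : ∀ {n : ℕ} (M : POVM d n) (k : Fin n), Measurable (response M k)
  response_nonneg : ∀ {n : ℕ} (M : POVM d n) (k : Fin n) (l : Λ), 0 ≤ response M k l
  sum_response : ∀ {n : ℕ} (M : POVM d n) (l : Λ), ∑ k, response M k l = 1
  born : ∀ {n : ℕ} (M : POVM d n) (k : Fin n) (ψ : PureState d),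
    ∫ l, response M k l ∂(epistemic ψ) = bornProb ψ.1 M k

attribute [instance] OntologicalModel.measurableSpace

/-- The epistemic state of a preparation: the same convex mixture of the epistemic states of the
pure states that are mixed. -/
noncomputable def OntologicalModel.epistemicOf {d : ℕ} (O : OntologicalModel d)
    (ρ : Preparation d) : Measure O.Λ :=
  ∑ i, ENNReal.ofReal (ρ.weight i) • O.epistemic (ρ.state i)

/-- Common epistemic overlap of `n` preparations in an ontological model. -/
noncomputable def OntologicalModel.epistemicOverlap {d n : ℕ} (O : OntologicalModel d)
    (ρ : Fin n → Preparation d) : ℝ :=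
  (commonOverlap fun x => O.epistemicOf (ρ x)).toReal

/-! ### Gaussian volume of caps and packing of complex lines. -/

theorem lintegral_exp_neg_mul_sq_norm {V : Type*} [NormedAddCommGroup V] [InnerProductSpace ℝ V]
    [FiniteDimensional ℝ V] [MeasurableSpace V] [BorelSpace V] {b : ℝ} (hb : 0 < b) :
    ∫⁻ v : V, ENNReal.ofReal (Real.exp (-b * ‖v‖ ^ 2)) =
      ENNReal.ofReal ((Real.pi / b) ^ (Module.finrank ℝ V / 2 : ℝ)) := by
  have h := GaussianFourier.integral_rexp_neg_mul_sq_norm (V := V) hb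
  rw [← h, ofReal_integral_eq_lintegral_ofReal _ (Filter.Eventually.of_forall fun v => by positivity)]
  -- A non-integrable function has Bochner integral 0 by convention, so a positive value forces
  -- integrability.
  by_contra hni
  rw [integral_undef hni] at h
  have : 0 < (Real.pi / b) ^ (Module.finrank ℝ V / 2 : ℝ) := by positivity
  linarith

theorem Complex.lintegral_exp_neg_sq_norm_of_le_sq_norm {a : ℝ} (ha : 0 ≤ a) :
    ∫⁻ z : ℂ in {z | a ≤ ‖z‖ ^ 2}, ENNReal.ofReal (Real.exp (-‖z‖ ^ 2)) =
      ENNReal.ofReal (Real.pi * Real.exp (-a)) := by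
  have hm : MeasurableSet {z : ℂ | a ≤ ‖z‖ ^ 2} := measurableSet_le (by fun_prop) (by fun_prop)
  rw [← lintegral_indicator hm, ← Complex.lintegral_comp_polarCoord_symm]
  have h1 : ∀ p ∈ polarCoord.target,
      ENNReal.ofReal p.1 • ({z : ℂ | a ≤ ‖z‖ ^ 2}.indicator
        (fun z : ℂ => ENNReal.ofReal (Real.exp (-‖z‖ ^ 2))) (Complex.polarCoord.symm p)) =
      ({r : ℝ | a ≤ r ^ 2}.indicator fun r => ENNReal.ofReal (r * Real.exp (-r ^ 2))) p.1 := by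
    rintro p hp
    have hp0 : 0 < p.1 := by simpa using (polarCoord_target ▸ hp).1
    have hn : ‖Complex.polarCoord.symm p‖ = p.1 := by
      rw [Complex.norm_polarCoord_symm, abs_of_pos hp0]
    by_cases h : a ≤ p.1 ^ 2
    · simp [Set.indicator, h, ENNReal.ofReal_mul hp0.le]
    · simp [Set.indicator, h]
  have hms : MeasurableSet {r : ℝ | a ≤ r ^ 2} := measurableSet_le (by fun_prop) (by fun_prop)
  rw [setLIntegral_congr_fun polarCoord.open_target.measurableSet h1, polarCoord_target,
    Measure.volume_eq_prod, ← Measure.prod_restrict, lintegral_prod _ (by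
      refine (Measurable.indicator (by fun_prop) hms).comp measurable_fst |>.aemeasurable)]
  simp only [lintegral_const, Measure.restrict_apply MeasurableSet.univ, Set.univ_inter,
    Real.volume_Ioo]
  rw [lintegral_mul_const _ (Measurable.indicator (by fun_prop) hms), lintegral_indicator hms,
    Measure.restrict_restrict hms]
  have hset : ({r : ℝ | a ≤ r ^ 2} ∩ Set.Ioi 0 : Set ℝ) =ᵐ[volume] Set.Ioi (√a) := by
    have : Set.Ioi (√a) =ᵐ[volume] Set.Ici (√a) := Ioi_ae_eq_Ici
    have h2 : (Set.Ioi 0 : Set ℝ) =ᵐ[volume] Set.Ici 0 := Ioi_ae_eq_Ici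
    refine (Filter.EventuallyEq.trans ?_ this.symm)
    have h3 : Set.Ici (√a) = {r : ℝ | a ≤ r ^ 2} ∩ Set.Ici 0 := by
      ext r
      simp only [Set.mem_Ici, Set.mem_inter_iff, Set.mem_ofPred_eq]
      constructor
      · intro h
        exact ⟨(Real.sqrt_le_left ((Real.sqrt_nonneg _).trans h)).1 h, (Real.sqrt_nonneg _).trans h⟩
      · rintro ⟨h, h0⟩
        exact (Real.sqrt_le_left h0).2 h
    rw [h3]
    exact Filter.EventuallyEq.inter (Filter.EventuallyEq.refl _ _) h2
  rw [setLIntegral_congr hset]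
  have hder : ∀ x ∈ Set.Ici (√a), HasDerivAt (fun r : ℝ => -(1 / 2) * Real.exp (-r ^ 2))
      (x * Real.exp (-x ^ 2)) x := by
    intro x _
    have := (((hasDerivAt_pow 2 x).neg).exp).const_mul (-(1 / 2) : ℝ)
    convert! this using 1
    norm_num
    ring
  have hlim : Filter.Tendsto (fun r : ℝ => -(1 / 2) * Real.exp (-r ^ 2)) Filter.atTop (nhds 0) := by
    have : Filter.Tendsto (fun r : ℝ => Real.exp (-r ^ 2)) Filter.atTop (nhds 0) :=
      Real.tendsto_exp_neg_atTop_nhds_zero.comp (Filter.tendsto_pow_atTop two_ne_zero)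
    simpa using this.const_mul (-(1 / 2) : ℝ)
  have hpos : ∀ x ∈ Set.Ioi (√a), 0 ≤ x * Real.exp (-x ^ 2) := fun x hx =>
    mul_nonneg ((Real.sqrt_nonneg a).trans (le_of_lt hx)) (Real.exp_nonneg _)
  have hint := integrableOn_Ioi_deriv_of_nonneg' hder hpos hlim
  have hval := integral_Ioi_of_hasDerivAt_of_nonneg' hder hpos hlim
  rw [← ofReal_integral_eq_lintegral_ofReal hint
    ((ae_restrict_iff' measurableSet_Ioi).2 (Filter.Eventually.of_forall hpos)), hval,
    ← ENNReal.ofReal_mul (by rw [Real.sq_sqrt ha]; simp; positivity), Real.sq_sqrt ha]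
  congr 1
  ring

/-- Extend `e` to an orthonormal basis and split off its coordinate. Real linearity is enough, since
the isometry is used only to transport Lebesgue measure. -/
theorem EuclideanSpace.exists_linearIsometryEquiv_fst_eq_inner {k : ℕ}
    (e : EuclideanSpace ℂ (Fin (k + 1))) (he : ‖e‖ = 1) :
    ∃ T : EuclideanSpace ℂ (Fin (k + 1)) ≃ₗᵢ[ℝ] WithLp 2 (ℂ × EuclideanSpace ℂ (Fin k)),
      ∀ x, (T x).fst = inner ℂ e x := by
  have ho : Orthonormal ℂ (({0} : Set (Fin (k + 1))).domRestrict fun _ => e) := by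
    refine ⟨fun i => he, fun i j hij => (hij (Subsingleton.elim _ _)).elim⟩
  obtain ⟨b, hb⟩ := ho.exists_orthonormalBasis_extension_of_card_eq (by simp)
  have hb0 : b 0 = e := hb 0 rfl
  let f : EuclideanSpace ℂ (Fin (k + 1)) →ₗᵢ[ℝ] WithLp 2 (ℂ × EuclideanSpace ℂ (Fin k)) :=
    { toFun := fun x => WithLp.toLp 2 (b.repr x 0, WithLp.toLp 2 fun i => b.repr x i.succ)
      map_add' := fun x y => by
        apply (WithLp.equiv 2 _).injective
        refine Prod.ext (by simp) ?_
        ext i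
        simp
      map_smul' := fun c x => by
        have h : b.repr (c • x) = c • b.repr x := by
          have := b.repr.map_smul (c : ℂ) x
          simpa only [Complex.coe_smul] using this
        apply (WithLp.equiv 2 _).injective
        refine Prod.ext (by simp [h]) ?_
        ext i
        simp [h]
      norm_map' := fun x => by
        rw [← sq_eq_sq₀ (norm_nonneg _) (norm_nonneg _), ← b.repr.norm_map x,
          EuclideanSpace.norm_sq_eq, WithLp.prod_norm_sq_eq_of_L2, Fin.sum_univ_succ]
        simp [EuclideanSpace.norm_sq_eq] }
  have hfin : Module.finrank ℝ (EuclideanSpace ℂ (Fin (k + 1))) =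
      Module.finrank ℝ (WithLp 2 (ℂ × EuclideanSpace ℂ (Fin k))) := by
    rw [(WithLp.linearEquiv 2 ℝ (ℂ × EuclideanSpace ℂ (Fin k))).finrank_eq, Module.finrank_prod,
      (WithLp.linearEquiv 2 ℝ (Fin k → ℂ)).finrank_eq,
      (WithLp.linearEquiv 2 ℝ (Fin (k + 1) → ℂ)).finrank_eq]
    simp [Complex.finrank_real_complex, Module.finrank_pi_fintype]
    ring
  refine ⟨f.toLinearIsometryEquiv hfin, fun x => ?_⟩
  change b.repr x 0 = _
  rw [b.repr_apply_apply, hb0]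

theorem EuclideanSpace.finrank_real_complex (k : ℕ) :
    Module.finrank ℝ (EuclideanSpace ℂ (Fin k)) = 2 * k := by
  rw [(WithLp.linearEquiv 2 ℝ (Fin k → ℂ)).finrank_eq]
  simp [Complex.finrank_real_complex, Module.finrank_pi_fintype]
  ring

theorem EuclideanSpace.lintegral_exp_neg_mul_sq_norm_complex (k : ℕ) {b : ℝ} (hb : 0 < b) :
    ∫⁻ v : EuclideanSpace ℂ (Fin k), ENNReal.ofReal (Real.exp (-b * ‖v‖ ^ 2)) =
      ENNReal.ofReal ((Real.pi / b) ^ k) := by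
  rw [lintegral_exp_neg_mul_sq_norm hb, EuclideanSpace.finrank_real_complex, ← Real.rpow_natCast]
  congr 2
  push_cast
  ring

/-- The Gaussian measure of the cone around a complex line. -/
theorem EuclideanSpace.setLIntegral_exp_neg_sq_norm_cone {k : ℕ}
    (e : EuclideanSpace ℂ (Fin (k + 1))) (he : ‖e‖ = 1) {ε : ℝ} (h0 : 0 < ε) (h1 : ε ≤ 1) :
    ∫⁻ x in {x | (1 - ε) * ‖x‖ ^ 2 ≤ ‖(inner ℂ e x : ℂ)‖ ^ 2},
        ENNReal.ofReal (Real.exp (-‖x‖ ^ 2)) =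
      ENNReal.ofReal (ε ^ k * Real.pi ^ (k + 1)) := by
  obtain ⟨T, hT⟩ := EuclideanSpace.exists_linearIsometryEquiv_fst_eq_inner e he
  set F := EuclideanSpace ℂ (Fin k)
  -- With `x = (z, y)` the cone is `s‖y‖² ≤ ‖z‖²`. The integral over `z` is `π exp(-s‖y‖²)`, and `s
  -- + 1 = 1/ε` leaves a Gaussian in `y` of total mass `(πε)^k`.
  set s : ℝ := (1 - ε) / ε with hs
  have hs0 : 0 ≤ s := div_nonneg (by linarith) h0.le
  let g : WithLp 2 (ℂ × F) → ℝ≥0∞ :=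
    fun h => {h : WithLp 2 (ℂ × F) | (1 - ε) * ‖h‖ ^ 2 ≤ ‖h.fst‖ ^ 2}.indicator
      (fun h => ENNReal.ofReal (Real.exp (-‖h‖ ^ 2))) h
  have hms : MeasurableSet {x : EuclideanSpace ℂ (Fin (k + 1)) |
      (1 - ε) * ‖x‖ ^ 2 ≤ ‖(inner ℂ e x : ℂ)‖ ^ 2} :=
    measurableSet_le (by fun_prop) (by fun_prop)
  have e1 : ∀ x, {x : EuclideanSpace ℂ (Fin (k + 1)) |
      (1 - ε) * ‖x‖ ^ 2 ≤ ‖(inner ℂ e x : ℂ)‖ ^ 2}.indicator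
        (fun x => ENNReal.ofReal (Real.exp (-‖x‖ ^ 2))) x = g (T x) := by
    intro x
    simp only [g, Set.indicator, Set.mem_ofPred_eq, hT, T.norm_map]
  rw [← lintegral_indicator hms, lintegral_congr e1,
    T.measurePreserving.lintegral_comp_emb T.toHomeomorph.measurableEmbedding]
  rw [← (WithLp.volume_preserving_toLp ℂ F).lintegral_comp_emb
    (MeasurableEquiv.toLp 2 (ℂ × F)).measurableEmbedding]
  have hmA : ∀ y : F, MeasurableSet {z : ℂ | s * ‖y‖ ^ 2 ≤ ‖z‖ ^ 2} := fun y =>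
    measurableSet_le (by fun_prop) (by fun_prop)
  have e2 : ∀ p : ℂ × F, g (WithLp.toLp 2 p) =
      {p : ℂ × F | s * ‖p.2‖ ^ 2 ≤ ‖p.1‖ ^ 2}.indicator
        (fun p => ENNReal.ofReal (Real.exp (-‖p.1‖ ^ 2)) *
          ENNReal.ofReal (Real.exp (-‖p.2‖ ^ 2))) p := by
    rintro ⟨z, y⟩
    have hiff : (1 - ε) * (‖z‖ ^ 2 + ‖y‖ ^ 2) ≤ ‖z‖ ^ 2 ↔ s * ‖y‖ ^ 2 ≤ ‖z‖ ^ 2 := by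
      rw [hs, div_mul_eq_mul_div, div_le_iff₀ h0]
      constructor <;> intro h <;> linarith
    have hnorm : ‖(WithLp.toLp 2 (z, y) : WithLp 2 (ℂ × F))‖ ^ 2 = ‖z‖ ^ 2 + ‖y‖ ^ 2 :=
      WithLp.prod_norm_sq_eq_of_L2 _
    simp only [g, Set.indicator, Set.mem_ofPred_eq, hnorm, WithLp.toLp_fst, hiff]
    rw [← ENNReal.ofReal_mul (Real.exp_nonneg _), ← Real.exp_add, neg_add]
  rw [lintegral_congr e2, Measure.volume_eq_prod, lintegral_prod_symm _ (by
    refine (Measurable.indicator (by fun_prop)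
      (measurableSet_le (by fun_prop) (by fun_prop))).aemeasurable)]
  have e3 : ∀ y : F, ∫⁻ z : ℂ, {p : ℂ × F | s * ‖p.2‖ ^ 2 ≤ ‖p.1‖ ^ 2}.indicator
        (fun p => ENNReal.ofReal (Real.exp (-‖p.1‖ ^ 2)) *
          ENNReal.ofReal (Real.exp (-‖p.2‖ ^ 2))) (z, y) =
      ENNReal.ofReal Real.pi * ENNReal.ofReal (Real.exp (-(1 / ε) * ‖y‖ ^ 2)) := by
    intro y
    have : ∀ z : ℂ, {p : ℂ × F | s * ‖p.2‖ ^ 2 ≤ ‖p.1‖ ^ 2}.indicator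
        (fun p => ENNReal.ofReal (Real.exp (-‖p.1‖ ^ 2)) *
          ENNReal.ofReal (Real.exp (-‖p.2‖ ^ 2))) (z, y) =
        {z : ℂ | s * ‖y‖ ^ 2 ≤ ‖z‖ ^ 2}.indicator
          (fun z => ENNReal.ofReal (Real.exp (-‖z‖ ^ 2))) z *
          ENNReal.ofReal (Real.exp (-‖y‖ ^ 2)) := by
      intro z
      by_cases h : s * ‖y‖ ^ 2 ≤ ‖z‖ ^ 2 <;> simp [Set.indicator, h]
    rw [lintegral_congr this, lintegral_mul_const _ (Measurable.indicator (by fun_prop) (hmA y)),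
      lintegral_indicator (hmA y),
      Complex.lintegral_exp_neg_sq_norm_of_le_sq_norm (by positivity),
      ENNReal.ofReal_mul Real.pi_pos.le, mul_assoc, ← ENNReal.ofReal_mul (Real.exp_nonneg _),
      ← Real.exp_add]
    congr 3
    rw [hs]
    field_simp
    ring
  rw [lintegral_congr e3, lintegral_const_mul _ (by fun_prop),
    EuclideanSpace.lintegral_exp_neg_mul_sq_norm_complex k (by positivity),
    ← ENNReal.ofReal_mul Real.pi_pos.le]
  congr 1
  rw [div_div_eq_mul_div, div_one, mul_pow]
  ring

/-- Greedy packing of complex lines: a cap of squared sine at most `ε` in `ℂ^(k+1)` has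
probability `ε ^ k`. -/
theorem EuclideanSpace.exists_norm_eq_one_forall_inner_lt {k : ℕ} {ε : ℝ} (h0 : 0 < ε)
    (h1 : ε ≤ 1) (S : Finset (EuclideanSpace ℂ (Fin (k + 1)))) (hS : ∀ e ∈ S, ‖e‖ = 1)
    (hcard : S.card * ε ^ k < 1) :
    ∃ x : EuclideanSpace ℂ (Fin (k + 1)), ‖x‖ = 1 ∧
      ∀ e ∈ S, ‖(inner ℂ e x : ℂ)‖ ^ 2 < 1 - ε := by
  set C : EuclideanSpace ℂ (Fin (k + 1)) → Set (EuclideanSpace ℂ (Fin (k + 1))) :=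
    fun e => {x | (1 - ε) * ‖x‖ ^ 2 ≤ ‖(inner ℂ e x : ℂ)‖ ^ 2} with hC
  -- Union bound: each cone has a fraction `ε ^ k` of the Gaussian mass. Cones are invariant under
  -- scaling, so an uncovered nonzero vector can be normalised afterwards.
  have hex : ∃ x, x ≠ 0 ∧ ∀ e ∈ S, x ∉ C e := by
    by_contra! hcon
    have hcov : (Set.univ : Set (EuclideanSpace ℂ (Fin (k + 1)))) ⊆ (⋃ e ∈ S, C e) ∪ {0} := by
      intro x _
      by_cases hx : x = 0
      · exact Or.inr hx
      · obtain ⟨e, he, hxe⟩ := hcon x hx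
        exact Or.inl (Set.mem_biUnion he hxe)
    have htot := EuclideanSpace.lintegral_exp_neg_mul_sq_norm_complex (k + 1) one_pos
    set γ : Measure (EuclideanSpace ℂ (Fin (k + 1))) :=
      volume.withDensity fun x => ENNReal.ofReal (Real.exp (-‖x‖ ^ 2)) with hγ
    have hcap : ∀ e ∈ S, γ (C e) = ENNReal.ofReal (ε ^ k * Real.pi ^ (k + 1)) := fun e he => by
      rw [hγ, withDensity_apply _ (measurableSet_le (by fun_prop) (by fun_prop)),
        EuclideanSpace.setLIntegral_exp_neg_sq_norm_cone e (hS e he) h0 h1]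
    have hz : γ {0} = 0 :=
      withDensity_absolutelyContinuous _ _ (measure_singleton 0)
    have huniv : γ Set.univ = ENNReal.ofReal (Real.pi ^ (k + 1)) := by
      rw [hγ, withDensity_apply _ MeasurableSet.univ, setLIntegral_univ]
      simpa using htot
    have hle : γ Set.univ ≤ S.card * ENNReal.ofReal (ε ^ k * Real.pi ^ (k + 1)) :=
      calc γ Set.univ ≤ γ ((⋃ e ∈ S, C e) ∪ {0}) := measure_mono hcov
        _ ≤ γ (⋃ e ∈ S, C e) + γ {0} := measure_union_le _ _
        _ ≤ ∑ e ∈ S, γ (C e) := by rw [hz, add_zero]; exact measure_biUnion_finset_le _ _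
        _ = _ := by rw [Finset.sum_congr rfl hcap]; simp
    rw [huniv, ← ENNReal.ofReal_natCast, ← ENNReal.ofReal_mul (by positivity),
      ENNReal.ofReal_le_ofReal_iff (by positivity)] at hle
    have : 0 < Real.pi ^ (k + 1) := by positivity
    nlinarith
  obtain ⟨x, hx, hxC⟩ := hex
  have hn : 0 < ‖x‖ := norm_pos_iff.2 hx
  refine ⟨(‖x‖ : ℂ)⁻¹ • x, by simp [norm_smul, hn.ne'], fun e he => ?_⟩
  have h := hxC e he
  simp only [hC, Set.mem_ofPred_eq, not_le] at h
  rw [inner_smul_right, norm_mul, mul_pow, norm_inv, Complex.norm_real, norm_norm, inv_pow,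
    inv_mul_lt_iff₀ (by positivity)]
  linarith

theorem EuclideanSpace.exists_packing {k N : ℕ} {ε : ℝ} (h0 : 0 < ε) (h1 : ε ≤ 1)
    (hN : N * ε ^ k ≤ 1) :
    ∃ χ : Fin N → EuclideanSpace ℂ (Fin (k + 1)), (∀ i, ‖χ i‖ = 1) ∧
      ∀ i j, i ≠ j → ‖(inner ℂ (χ i) (χ j) : ℂ)‖ ^ 2 < 1 - ε := by
  induction N with
  | zero => exact ⟨fun i => i.elim0, fun i => i.elim0, fun i => i.elim0⟩
  | succ N ih =>
    have hp : 0 < ε ^ k := by positivity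
    push_cast at hN
    obtain ⟨χ, hχ, hsep⟩ := ih (by linarith)
    classical
    obtain ⟨x, hx, hxs⟩ := EuclideanSpace.exists_norm_eq_one_forall_inner_lt h0 h1
      (Finset.univ.image χ) (by simpa using hχ) (by
        have : ((Finset.univ.image χ).card : ℝ) ≤ N := by
          exact_mod_cast Finset.card_image_le.trans (by simp)
        nlinarith)
    refine ⟨Fin.cons x χ, fun i => ?_, fun i j hij => ?_⟩
    · cases i using Fin.cases <;> simp [hx, hχ]
    · cases i using Fin.cases with
      | zero =>
        cases j using Fin.cases with
        | zero => exact (hij rfl).elim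
        | succ j =>
          rw [Fin.cons_zero, Fin.cons_succ, norm_inner_symm]
          exact hxs _ (by simp)
      | succ i =>
        cases j using Fin.cases with
        | zero => exact hxs _ (by simp)
        | succ j => exact hsep i j fun h => hij (by rw [h])

/-! ### Measurements that exclude one state each. -/

-- A splitting of the Gram matrix lifts to a measurement. `B = V (VᴴV)⁻¹` satisfies `VᴴB = 1`, so `B
-- G_x Bᴴ` compresses back to `G_x`, and these effects sum to the projector onto the range of `V`.
-- The complementary projector `Q` kills `V` and can be added to any outcome; 0 is chosen.
open Matrix in
theorem POVM.exists_of_sum_eq_conjTranspose_mul_self {d n : ℕ} (V : Matrix (Fin d) (Fin (n + 1)) ℂ)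
    (G : Fin (n + 1) → Matrix (Fin (n + 1)) (Fin (n + 1)) ℂ) (hG : ∀ x, (G x).PosSemidef)
    (hzero : ∀ x, G x x x = 0) (hsum : ∑ x, G x = Vᴴ * V) (hV : IsUnit (Vᴴ * V).det) :
    ∃ M : POVM d (n + 1), ∀ x, (Vᴴ * M.effect x * V) x x = 0 := by
  set H := (Vᴴ * V)⁻¹ with hH
  have h1 : H * (Vᴴ * V) = 1 := nonsing_inv_mul _ hV
  have h2 : Vᴴ * V * H = 1 := mul_nonsing_inv _ hV
  have hHh : Hᴴ = H := by rw [hH, conjTranspose_nonsing_inv]; simp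
  set B := V * H with hB
  have hBh : Bᴴ = H * Vᴴ := by rw [hB, conjTranspose_mul, hHh]
  have h3 : Vᴴ * B = 1 := by rw [hB, ← Matrix.mul_assoc, h2]
  have h4 : Bᴴ * V = 1 := by rw [hBh, Matrix.mul_assoc, h1]
  set Q := 1 - B * Vᴴ with hQ
  have hP : (B * Vᴴ)ᴴ = B * Vᴴ := by
    rw [conjTranspose_mul, conjTranspose_conjTranspose, hBh, hB, Matrix.mul_assoc]
  have hPP : B * Vᴴ * (B * Vᴴ) = B * Vᴴ := by
    rw [Matrix.mul_assoc, ← Matrix.mul_assoc Vᴴ, h3, Matrix.one_mul]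
  have hQpos : Q.PosSemidef := by
    have : Qᴴ * Q = Q := by
      rw [hQ, conjTranspose_sub, hP, conjTranspose_one, Matrix.sub_mul, Matrix.one_mul,
        Matrix.mul_sub, Matrix.mul_one, hPP]
      simp
    rw [← this]
    exact posSemidef_conjTranspose_mul_self Q
  have hQV : Q * V = 0 := by
    rw [hQ, Matrix.sub_mul, hB, Matrix.mul_assoc, Matrix.mul_assoc, h1]
    simp
  refine ⟨⟨fun x => B * G x * Bᴴ + if x = 0 then Q else 0, fun x => ?_, ?_⟩, fun x => ?_⟩
  · refine ((hG x).mul_mul_conjTranspose_same B).add ?_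
    split_ifs
    exacts [hQpos, PosSemidef.zero]
  · rw [Finset.sum_add_distrib, ← Matrix.sum_mul, ← Matrix.mul_sum, hsum, hBh,
      Matrix.mul_assoc B, ← Matrix.mul_assoc (Vᴴ * V), h2, Matrix.one_mul]
    simp [hQ]
  · have : Vᴴ * (B * G x * Bᴴ + if x = 0 then Q else 0) * V = G x := by
      rw [Matrix.mul_add, Matrix.add_mul]
      have e1 : Vᴴ * (B * G x * Bᴴ) * V = G x := by
        rw [Matrix.mul_assoc B, ← Matrix.mul_assoc Vᴴ, h3, Matrix.one_mul, Matrix.mul_assoc, h4,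
          Matrix.mul_one]
      have e2 : Vᴴ * (if x = 0 then Q else 0) * V = 0 := by
        split_ifs
        · rw [Matrix.mul_assoc, hQV, Matrix.mul_zero]
        · simp
      rw [e1, e2, add_zero]
    rw [this, hzero]

open Matrix in
/-- The positive semidefinite matrix supported on the rows and columns `i` and `j`, with diagonal
entries `p`, `q` and off-diagonal entry `g`. -/
theorem Matrix.posSemidef_vecMulVec_add_single {n : ℕ} {p q : ℝ} (g : ℂ) (hp : 0 < p)
    (h : ‖g‖ ^ 2 ≤ p * q) (i j : Fin n) :
    (((p : ℂ)⁻¹ • vecMulVec (Pi.single i (p : ℂ) + Pi.single j (star g))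
      (star (Pi.single i (p : ℂ) + Pi.single j (star g)))) +
      Matrix.diagonal (Pi.single j ((q - ‖g‖ ^ 2 / p : ℝ) : ℂ))).PosSemidef := by
  -- The rank-one term carries row and column `i`; the diagonal remainder is the Schur complement `q
  -- - ‖g‖²/p`.
  refine ((posSemidef_vecMulVec_self_star _).smul ?_).add (PosSemidef.diagonal ?_)
  · rw [← Complex.ofReal_inv]
    exact_mod_cast (inv_pos.2 hp).le
  · rw [Pi.single_nonneg]
    have : ‖g‖ ^ 2 / p ≤ q := by rw [div_le_iff₀ hp]; linarith
    exact_mod_cast sub_nonneg.2 this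

/-- The pure state of a unit vector. -/
noncomputable def PureState.ofVector {d : ℕ} (v : EuclideanSpace ℂ (Fin d)) (hv : ‖v‖ = 1) :
    PureState d :=
  ⟨Matrix.of fun i j => v i * star (v j), v, hv, rfl⟩

open Matrix in
theorem bornProb_ofVector {d n : ℕ} (v : EuclideanSpace ℂ (Fin d)) (hv : ‖v‖ = 1) (M : POVM d n)
    (k : Fin n) :
    bornProb (PureState.ofVector v hv).1 M k = (star v.ofLp ⬝ᵥ M.effect k *ᵥ v.ofLp).re := by
  simp only [bornProb, PureState.ofVector, Matrix.trace, Matrix.mul_apply, Matrix.diag,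
    Matrix.of_apply, dotProduct, mulVec, Finset.mul_sum, Pi.star_apply]
  rw [Finset.sum_comm]
  congr 1
  refine Finset.sum_congr rfl fun i _ => Finset.sum_congr rfl fun j _ => ?_
  ring

open Matrix in
/-- Anti-distinguishability of three pure states, one of which has the same small overlap with
the two others. -/
theorem POVM.exists_bornProb_eq_zero {d : ℕ} (v : Fin 3 → EuclideanSpace ℂ (Fin d))
    (hv : ∀ x, ‖v x‖ = 1) {c : ℝ} (h01 : ‖(inner ℂ (v 0) (v 1) : ℂ)‖ ^ 2 ≤ c)
    (h02 : ‖(inner ℂ (v 0) (v 2) : ℂ)‖ ^ 2 ≤ c) (h12 : ‖(inner ℂ (v 1) (v 2) : ℂ)‖ < 1 - 2 * c) :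
    ∃ M : POVM d 3, ∀ x, bornProb (PureState.ofVector (v x) (hv x)).1 M x = 0 := by
  set a : ℂ := inner ℂ (v 0) (v 1) with ha
  set b : ℂ := inner ℂ (v 0) (v 2) with hb
  set w : ℂ := inner ℂ (v 1) (v 2) with hw
  let V : Matrix (Fin d) (Fin 3) ℂ := Matrix.of fun i x => v x i
  have hgram : ∀ x y, (Vᴴ * V) x y = inner ℂ (v x) (v y) := fun x y => by
    simp [V, Matrix.mul_apply, PiLp.inner_apply, mul_comm]
  have hcol : ∀ (E : Matrix (Fin d) (Fin d) ℂ) x,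
      (Vᴴ * E * V) x x = star (v x).ofLp ⬝ᵥ E *ᵥ (v x).ofLp := fun E x => by
    rw [Matrix.mul_assoc]
    rfl
  have hG : Vᴴ * V = !![1, a, b; star a, 1, w; star b, star w, 1] := by
    ext x y
    rw [hgram]
    fin_cases x <;> fin_cases y <;> simp [hv, ha, hb, hw]
  have hcw : 0 < 1 - 2 * c := (norm_nonneg _).trans_lt h12
  -- By `‖a‖² + ‖b‖² ≤ 2c` and `2‖a‖‖b‖ ≤ 2c`, the determinant is at least `(1 + ‖w‖)(1 - 2c - ‖w‖)
  -- > 0`.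
  have hdet : IsUnit (Vᴴ * V).det := by
    rw [hG, isUnit_iff_ne_zero, det_fin_three]
    intro h0
    have hre := congrArg Complex.re h0
    have key : 1 - ‖a‖ ^ 2 - ‖b‖ ^ 2 - ‖w‖ ^ 2 + 2 * (a * w * star b).re = 0 := by
      rw [← Complex.normSq_eq_norm_sq, ← Complex.normSq_eq_norm_sq, ← Complex.normSq_eq_norm_sq]
      simp [Complex.normSq_apply] at hre ⊢
      linarith
    have hb1 : |(a * w * star b).re| ≤ ‖a‖ * ‖w‖ * ‖b‖ := by
      refine (Complex.abs_re_le_norm _).trans_eq ?_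
      rw [norm_mul, norm_mul, norm_star]
    have hb2 := (abs_le.1 hb1).1
    have hab : 2 * (‖a‖ * ‖b‖) ≤ 2 * c := by nlinarith [sq_nonneg (‖a‖ - ‖b‖)]
    have hw0 := norm_nonneg w
    nlinarith [mul_le_mul_of_nonneg_right hab hw0, mul_pos (by linarith : 0 < 1 + ‖w‖)
      (by linarith : 0 < 1 - 2 * c - ‖w‖)]
  -- The Gram matrix is a sum of three 2×2 blocks, one per pair of states. The unit diagonal splits
  -- as `1/2 + 1/2` at `v 0` and as `(1 - 2c) + 2c` at the other two, so positivity needs exactly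
  -- `‖w‖ ≤ 1 - 2c` and `‖a‖², ‖b‖² ≤ (1/2)(2c)`.
  have P0 := Matrix.posSemidef_vecMulVec_add_single (n := 3) (q := 1 - 2 * c) w hcw
    (by nlinarith [norm_nonneg w]) 1 2
  have P1 := Matrix.posSemidef_vecMulVec_add_single (n := 3) (p := 1 / 2) (q := 2 * c) b (by norm_num)
    (by linarith) 0 2
  have P2 := Matrix.posSemidef_vecMulVec_add_single (n := 3) (p := 1 / 2) (q := 2 * c) a (by norm_num)
    (by linarith) 0 1
  have hcw' : (1 - 2 * c : ℂ) ≠ 0 := by exact_mod_cast hcw.ne'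
  obtain ⟨M, hM⟩ := POVM.exists_of_sum_eq_conjTranspose_mul_self V ![_, _, _]
    (by intro x; fin_cases x; exacts [P0, P1, P2])
    (by intro x; fin_cases x <;> simp [vecMulVec_apply])
    (by
      have ea := Complex.mul_conj' a
      have eb := Complex.mul_conj' b
      have ew := Complex.mul_conj' w
      rw [hG, Fin.sum_univ_three]
      ext x y
      fin_cases x <;> fin_cases y <;> simp [vecMulVec_apply] <;> field_simp <;>
        (try simp only [mul_comm ((starRingEnd ℂ) _), ea, eb, ew]) <;> ring)
    hdet
  refine ⟨M, fun x => ?_⟩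
  rw [bornProb_ofVector, ← hcol, hM, Complex.zero_re]

/-! ### Lower bound on the quantum overlap. -/

-- Write `A = CᴴC` and `B = DᴴD`, so `⟨v, w⟩ = ⟨Cv, Cw⟩ + ⟨Dv, Dw⟩`. As `C` and `D` are contractions
-- on unit vectors, the modulus is at most `‖Cv‖ + ‖Dw‖`. Thus fidelity bounds from below the total
-- probability of the outcomes that `antiDistinguishability` does not count.
open Matrix in
open scoped MatrixOrder Matrix.Norms.L2Operator in
theorem Matrix.sq_norm_dotProduct_le_of_add_eq_one {d : ℕ} {A B : Matrix (Fin d) (Fin d) ℂ}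
    (hA : A.PosSemidef) (hB : B.PosSemidef) (hAB : A + B = 1) (v w : EuclideanSpace ℂ (Fin d))
    (hv : ‖v‖ = 1) (hw : ‖w‖ = 1) :
    ‖(inner ℂ v w : ℂ)‖ ^ 2 ≤
      2 * ((star v.ofLp ⬝ᵥ A *ᵥ v.ofLp).re + (star w.ofLp ⬝ᵥ B *ᵥ w.ofLp).re) := by
  obtain ⟨C, rfl⟩ := CStarAlgebra.nonneg_iff_eq_star_mul_self.1 hA.nonneg
  obtain ⟨D, rfl⟩ := CStarAlgebra.nonneg_iff_eq_star_mul_self.1 hB.nonneg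
  rw [star_eq_conjTranspose, star_eq_conjTranspose] at *
  let f (E : Matrix (Fin d) (Fin d) ℂ) (x : EuclideanSpace ℂ (Fin d)) :
    EuclideanSpace ℂ (Fin d) := WithLp.toLp 2 (E *ᵥ x.ofLp)
  have hf : ∀ E x y, (inner ℂ (f E x) (f E y) : ℂ) = star x.ofLp ⬝ᵥ (Eᴴ * E) *ᵥ y.ofLp := by
    intro E x y
    rw [EuclideanSpace.inner_eq_star_dotProduct, dotProduct_comm, star_mulVec, ← mulVec_mulVec,
      dotProduct_mulVec (star x.ofLp)]
  have hn : ∀ E x, (star x.ofLp ⬝ᵥ (Eᴴ * E) *ᵥ x.ofLp).re = ‖f E x‖ ^ 2 := fun E x => by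
    rw [← hf, inner_self_eq_norm_sq_to_K]
    norm_cast
  have hadd : ∀ x y, (inner ℂ (f C x) (f C y) : ℂ) + inner ℂ (f D x) (f D y) = inner ℂ x y := by
    intro x y
    rw [hf, hf, ← dotProduct_add, ← add_mulVec, hAB, one_mulVec,
      EuclideanSpace.inner_eq_star_dotProduct, dotProduct_comm]
  have hle : ∀ x, ‖x‖ = 1 → ‖f C x‖ ^ 2 + ‖f D x‖ ^ 2 = 1 := fun x hx => by
    have := congrArg Complex.re (hadd x x)
    simp only [inner_self_eq_norm_sq_to_K, hx] at this
    norm_num at this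
    exact_mod_cast this
  rw [hn, hn, ← hadd]
  have h1 : ‖f C w‖ ≤ 1 := by nlinarith [hle w hw, sq_nonneg ‖f D w‖, norm_nonneg (f C w)]
  have h2 : ‖f D v‖ ≤ 1 := by nlinarith [hle v hv, sq_nonneg ‖f C v‖, norm_nonneg (f D v)]
  have h3 : ‖(inner ℂ (f C v) (f C w) : ℂ) + inner ℂ (f D v) (f D w)‖ ≤ ‖f C v‖ + ‖f D w‖ :=
    (norm_add_le _ _).trans (add_le_add
      ((norm_inner_le_norm _ _).trans (mul_le_of_le_one_right (norm_nonneg _) h1))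
      ((norm_inner_le_norm _ _).trans (mul_le_of_le_one_left (norm_nonneg _) h2)))
  nlinarith [sq_nonneg (‖f C v‖ - ‖f D w‖), norm_nonneg
    ((inner ℂ (f C v) (f C w) : ℂ) + inner ℂ (f D v) (f D w)), norm_nonneg (f C v),
    norm_nonneg (f D w)]

theorem sum_bornProb {d n : ℕ} (ψ : PureState d) (M : POVM d n) :
    ∑ k, bornProb ψ.1 M k = 1 := by
  obtain ⟨v, hv, h⟩ := ψ.2
  simp only [bornProb]
  rw [← Complex.re_sum, ← Matrix.trace_sum, ← Matrix.mul_sum, M.sum_eq_one, Matrix.mul_one, h]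
  have := EuclideanSpace.norm_sq_eq v
  rw [hv] at this
  simp only [Matrix.trace, Matrix.diag, Matrix.of_apply, Complex.re_sum]
  rw [one_pow] at this
  rw [this]
  refine Finset.sum_congr rfl fun i _ => ?_
  rw [← Complex.normSq_eq_norm_sq]
  simp [Complex.normSq_apply]

theorem bornProb_pure {d n : ℕ} (ψ : PureState d) (M : POVM d n) (k : Fin n) :
    bornProb (Preparation.pure ψ).density M k = bornProb ψ.1 M k := by
  congr 1
  change ∑ _i : Fin 1, ((1 : ℝ) : ℂ) • ψ.1 = ψ.1
  simp

theorem bornProb_uniform {d n m : ℕ} (hm : 0 < m) (φ : Fin m → PureState d) (M : POVM d n)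
    (k : Fin n) :
    bornProb (Preparation.uniform hm φ).density M k = (∑ i, bornProb (φ i).1 M k) / m := by
  simp only [bornProb, Preparation.density, Preparation.uniform, Matrix.sum_mul, Matrix.smul_mul,
    Matrix.trace_sum, Matrix.trace_smul, Complex.re_sum, smul_eq_mul, Complex.re_ofReal_mul]
  rw [← Finset.mul_sum, one_div_mul_eq_div]
  rfl

/-- A mixture whose components all have fidelity `c` with a pure state has quantum overlap at
least `c / 2` with it. -/
theorem le_quantumOverlap_pure_uniform {d m : ℕ} (hm : 0 < m) {c : ℝ} (hc : c ≤ 2)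
    (v : EuclideanSpace ℂ (Fin d)) (hv : ‖v‖ = 1) (w : Fin m → EuclideanSpace ℂ (Fin d))
    (hw : ∀ i, ‖w i‖ = 1) (h : ∀ i, ‖(inner ℂ v (w i) : ℂ)‖ ^ 2 = c) :
    c / 2 ≤ quantumOverlap ![Preparation.pure (PureState.ofVector v hv),
      Preparation.uniform hm fun i => PureState.ofVector (w i) (hw i)] := by
  have key : antiDistinguishability ![Preparation.pure (PureState.ofVector v hv),
      Preparation.uniform hm fun i => PureState.ofVector (w i) (hw i)] ≤ 1 - c / 4 := by
    -- The bound must also be nonnegative, because an empty real supremum is 0; this is where `c ≤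
    -- 2` enters.
    refine Real.iSup_le (fun M => ?_) (by linarith)
    have f0 : Finset.univ.filter (fun k : Fin 2 => k ≠ 0) = {1} := by decide
    have f1 : Finset.univ.filter (fun k : Fin 2 => k ≠ 1) = {0} := by decide
    rw [Fin.sum_univ_two, f0, f1, Finset.sum_singleton, Finset.sum_singleton]
    simp only [Matrix.cons_val_zero, Matrix.cons_val_one]
    rw [bornProb_pure, bornProb_uniform]
    have hM : M.effect 0 + M.effect 1 = 1 := by rw [← M.sum_eq_one, Fin.sum_univ_two]
    have hv2 := sum_bornProb (PureState.ofVector v hv) M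
    rw [Fin.sum_univ_two] at hv2
    have hi : ∀ i, bornProb (PureState.ofVector (w i) (hw i)).1 M 0 ≤
        2 - c / 2 - bornProb (PureState.ofVector v hv).1 M 1 := fun i => by
      have h1 := Matrix.sq_norm_dotProduct_le_of_add_eq_one (M.posSemidef 0) (M.posSemidef 1) hM
        v (w i) hv (hw i)
      rw [h i, ← bornProb_ofVector v hv M 0, ← bornProb_ofVector (w i) (hw i) M 1] at h1
      have h2 := sum_bornProb (PureState.ofVector (w i) (hw i)) M
      rw [Fin.sum_univ_two] at h2
      linarith
    have hs : (∑ i, bornProb (PureState.ofVector (w i) (hw i)).1 M 0) / m ≤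
        2 - c / 2 - bornProb (PureState.ofVector v hv).1 M 1 := by
      rw [div_le_iff₀ (by exact_mod_cast hm)]
      refine (Finset.sum_le_sum fun i _ => hi i).trans_eq ?_
      rw [Finset.sum_const, Finset.card_univ, Fintype.card_fin, nsmul_eq_mul, mul_comm]
    push_cast
    linarith
  rw [quantumOverlap]
  push_cast
  linarith

/-! ### Disjointness of the epistemic overlaps. -/

namespace OntologicalModel

/-- Response `x` has zero mean under state `x`, so it vanishes almost everywhere that `f x ≠ 0`.
Were all densities nonzero at `l`, all responses would vanish there, although they sum to 1. -/
theorem ae_exists_density_eq_zero {d n : ℕ} (O : OntologicalModel.{u} d)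
    (ψ : Fin n → PureState d) (M : POVM d n) (hM : ∀ x, bornProb (ψ x).1 M x = 0)
    (σ : Measure O.Λ) (f : Fin n → O.Λ → ℝ≥0∞) (hf : ∀ x, Measurable (f x))
    (hσ : ∀ x, O.epistemic (ψ x) = σ.withDensity (f x)) :
    ∀ᵐ l ∂σ, ∃ x, f x l = 0 := by
  have h : ∀ x, ∀ᵐ l ∂σ, f x l ≠ 0 → O.response M x l = 0 := fun x => by
    have := O.isProbabilityMeasure (ψ x)
    have hint : Integrable (O.response M x) (O.epistemic (ψ x)) := by
      refine Integrable.of_bound (O.measurable_response M x).aestronglyMeasurable 1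
        (Filter.Eventually.of_forall fun l => ?_)
      rw [Real.norm_of_nonneg (O.response_nonneg M x l), ← O.sum_response M l]
      exact Finset.single_le_sum (fun y _ => O.response_nonneg M y l) (Finset.mem_univ x)
    have h0 := O.born M x (ψ x)
    rw [hM, integral_eq_zero_iff_of_nonneg (O.response_nonneg M x) hint, hσ] at h0
    exact (ae_withDensity_iff (hf x)).1 h0
  filter_upwards [ae_all_iff.2 h] with l hl
  by_contra! hcon
  have := O.sum_response M l
  rw [Finset.sum_eq_zero fun x _ => hl x (hcon x)] at this
  exact zero_ne_one this

theorem epistemicOf_pure {d : ℕ} (O : OntologicalModel.{u} d) (ψ : PureState d) :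
    O.epistemicOf (Preparation.pure ψ) = O.epistemic ψ := by
  change ∑ _i : Fin 1, ENNReal.ofReal 1 • O.epistemic ψ = O.epistemic ψ
  simp

theorem epistemicOf_uniform {d m : ℕ} (O : OntologicalModel.{u} d) (hm : 0 < m)
    (φ : Fin m → PureState d) (σ : Measure O.Λ) (f : Fin m → O.Λ → ℝ≥0∞)
    (hf : ∀ i, Measurable (f i)) (hσ : ∀ i, O.epistemic (φ i) = σ.withDensity (f i)) :
    O.epistemicOf (Preparation.uniform hm φ) =
      σ.withDensity fun l => ∑ i, ENNReal.ofReal (1 / (m : ℝ)) * f i l := by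
  ext s hs
  rw [withDensity_apply _ hs, lintegral_finsetSum _ (fun i _ => (hf i).const_mul _)]
  simp only [epistemicOf, Preparation.uniform, Measure.coe_finsetSum, Finset.sum_apply,
    Measure.smul_apply, smul_eq_mul]
  refine Finset.sum_congr rfl fun i _ => ?_
  rw [lintegral_const_mul _ (hf i), hσ, withDensity_apply _ hs]

/-- If every component of the `k`-th mixture, every component of the `k'`-th mixture and `ψ₀` are
anti-distinguishable for `k ≠ k'`, the overlaps of the mixtures with `ψ₀` are disjoint. -/
theorem sum_epistemicOverlap_le_one {d n m : ℕ} (O : OntologicalModel.{u} d) (hm : 0 < m)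
    (ψ₀ : PureState d) (φ : Fin n → Fin m → PureState d)
    (h : ∀ k k', k ≠ k' → ∀ i i', ∃ M : POVM d 3,
      ∀ x, bornProb (![ψ₀, φ k i, φ k' i'] x).1 M x = 0) :
    ∑ k, O.epistemicOverlap ![Preparation.pure ψ₀, Preparation.uniform hm (φ k)] ≤ 1 := by
  have hprob := O.isProbabilityMeasure
  -- A single measure dominating all the states, so that the overlaps for different `k` can be
  -- compared pointwise.
  set σ : Measure O.Λ := O.epistemic ψ₀ + ∑ p : Fin n × Fin m, O.epistemic (φ p.1 p.2) with hσ
  let f₀ := (O.epistemic ψ₀).rnDeriv σ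
  let f (k : Fin n) (i : Fin m) := (O.epistemic (φ k i)).rnDeriv σ
  have hf₀ : Measurable f₀ := Measure.measurable_rnDeriv _ _
  have hf : ∀ k i, Measurable (f k i) := fun k i => Measure.measurable_rnDeriv _ _
  have e₀ : O.epistemic ψ₀ = σ.withDensity f₀ :=
    (Measure.withDensity_rnDeriv_eq _ _ (Measure.le_add_right le_rfl).absolutelyContinuous).symm
  have e : ∀ k i, O.epistemic (φ k i) = σ.withDensity (f k i) := fun k i =>
    (Measure.withDensity_rnDeriv_eq _ _ (Measure.le_add_left
      (Finset.single_le_sum (f := fun p : Fin n × Fin m => O.epistemic (φ p.1 p.2))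
        (fun _ _ => Measure.zero_le _) (Finset.mem_univ (k, i)))).absolutelyContinuous).symm
  let g (k : Fin n) : O.Λ → ℝ≥0∞ := fun l => ∑ i, ENNReal.ofReal (1 / (m : ℝ)) * f k i l
  have hg : ∀ k, Measurable (g k) := fun k =>
    Finset.measurable_fun_sum _ fun i _ => (hf k i).const_mul _
  have eg : ∀ k, O.epistemicOf (Preparation.uniform hm (φ k)) = σ.withDensity (g k) := fun k =>
    O.epistemicOf_uniform hm (φ k) σ (f k) (hf k) (e k)
  have hov : ∀ k, O.epistemicOverlap ![Preparation.pure ψ₀, Preparation.uniform hm (φ k)] =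
      (∫⁻ l, min (f₀ l) (g k l) ∂σ).toReal := fun k => by
    have hx : (fun x => O.epistemicOf
        ((![Preparation.pure ψ₀, Preparation.uniform hm (φ k)] : Fin 2 → Preparation d) x)) =
        fun x => σ.withDensity ((![f₀, g k] : Fin 2 → O.Λ → ℝ≥0∞) x) := by
      funext x
      fin_cases x
      · simp [epistemicOf_pure, ← e₀]
      · simp [eg]
    have hfin : ∀ x, IsFiniteMeasure (σ.withDensity ((![f₀, g k] : Fin 2 → O.Λ → ℝ≥0∞) x)) := by
      intro x
      rw [← congrFun hx x]
      unfold epistemicOf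
      have : ∀ (ρ : Preparation d) i, IsFiniteMeasure
          (ENNReal.ofReal (ρ.weight i) • O.epistemic (ρ.state i)) := fun ρ i =>
        Measure.smul_finite _ ENNReal.ofReal_ne_top
      infer_instance
    rw [epistemicOverlap, hx]
    refine congrArg ENNReal.toReal ((commonOverlap_withDensity (n := 2) two_pos σ _ (by
      intro x; fin_cases x; exacts [hf₀, hg k]) hfin).trans ?_)
    refine lintegral_congr fun l => ?_
    refine le_antisymm (le_min (iInf_le _ 0) (iInf_le _ 1)) (le_iInf fun x => ?_)
    fin_cases x
    exacts [min_le_left _ _, min_le_right _ _]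
  have hdisj : ∀ᵐ l ∂σ, ∀ k k', k ≠ k' → ∀ i i', f₀ l = 0 ∨ f k i l = 0 ∨ f k' i' l = 0 := by
    rw [ae_all_iff]; intro k
    rw [ae_all_iff]; intro k'
    by_cases hkk : k = k'
    · exact Filter.Eventually.of_forall fun l hne => (hne hkk).elim
    have : ∀ᵐ l ∂σ, ∀ i i', f₀ l = 0 ∨ f k i l = 0 ∨ f k' i' l = 0 := by
      rw [ae_all_iff]; intro i
      rw [ae_all_iff]; intro i'
      obtain ⟨M, hM⟩ := h k k' hkk i i'
      filter_upwards [O.ae_exists_density_eq_zero ![ψ₀, φ k i, φ k' i'] M hM σ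
        ![f₀, f k i, f k' i'] (by intro x; fin_cases x; exacts [hf₀, hf _ _, hf _ _])
        (by intro x; fin_cases x; exacts [e₀, e _ _, e _ _])] with l hl
      obtain ⟨x, hx⟩ := hl
      fin_cases x
      exacts [Or.inl hx, Or.inr (Or.inl hx), Or.inr (Or.inr hx)]
    filter_upwards [this] with l hl _ using hl
  -- At almost every point at most one summand is nonzero: two of them would supply components of
  -- distinct mixtures with positive densities alongside `f₀`.
  have hle : ∀ᵐ l ∂σ, ∑ k, min (f₀ l) (g k l) ≤ f₀ l := by
    filter_upwards [hdisj] with l hl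
    by_cases hall : ∀ k, min (f₀ l) (g k l) = 0
    · simp [hall]
    · push Not at hall
      obtain ⟨k, hk⟩ := hall
      rw [Finset.sum_eq_single k]
      · exact min_le_left _ _
      · intro k' _ hne
        by_contra hk'
        have hex : ∀ j, min (f₀ l) (g j l) ≠ 0 → f₀ l ≠ 0 ∧ ∃ i, f j i l ≠ 0 := by
          intro j hj
          refine ⟨fun h0 => hj (by simp [h0]), ?_⟩
          by_contra! hcon
          exact hj (by simp [g, hcon])
        obtain ⟨h0, i, hi⟩ := hex k hk
        obtain ⟨-, i', hi'⟩ := hex k' hk'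
        rcases hl k k' hne.symm i i' with h | h | h
        exacts [h0 h, hi h, hi' h]
      · simp
  have hone : ∫⁻ l, f₀ l ∂σ = 1 := by
    rw [← setLIntegral_univ, ← withDensity_apply _ MeasurableSet.univ, ← e₀, measure_univ]
  have hsum : ∑ k, ∫⁻ l, min (f₀ l) (g k l) ∂σ ≤ 1 := by
    rw [← lintegral_finsetSum _ fun k _ => hf₀.min (hg k), ← hone]
    exact lintegral_mono_ae hle
  simp only [hov]
  rw [← ENNReal.toReal_sum fun k _ => ne_top_of_le_ne_top ENNReal.one_ne_top
    ((Finset.single_le_sum (fun _ _ => zero_le) (Finset.mem_univ k)).trans hsum)]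
  exact ENNReal.toReal_le_of_le_ofReal zero_le_one (by simpa using hsum)

end OntologicalModel

/-! ### Choice of the states and the final estimate. -/

/-- Applying the common projector to `v` gives `v = ⟨w, v⟩ w`. Distinctness of states then follows
from inner products of modulus below 1. -/
theorem PureState.norm_inner_eq_one_of_ofVector_eq {d : ℕ} {v w : EuclideanSpace ℂ (Fin d)}
    {hv : ‖v‖ = 1} {hw : ‖w‖ = 1} (h : PureState.ofVector v hv = PureState.ofVector w hw) :
    ‖(inner ℂ w v : ℂ)‖ = 1 := by
  have hij : ∀ i j, v i * star (v j) = w i * star (w j) := fun i j =>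
    congrFun (congrFun (congrArg Subtype.val h) i) j
  have hvv : ∑ j, star (v j) * v j = 1 := by
    have : (inner ℂ v v : ℂ) = 1 := by rw [inner_self_eq_norm_sq_to_K, hv]; simp
    rw [← this, PiLp.inner_apply]
    exact Finset.sum_congr rfl fun j _ => by simp [mul_comm, Complex.mul_conj']
  have hvw : v = (inner ℂ w v : ℂ) • w := by
    ext i
    rw [← mul_one (v i), ← hvv, Finset.mul_sum, PiLp.smul_apply, PiLp.inner_apply, smul_eq_mul,
      Finset.sum_mul]
    refine Finset.sum_congr rfl fun j _ => ?_
    rw [← mul_assoc, hij]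
    simp
    ring
  have := congrArg norm hvw
  rw [norm_smul, hv, hw, mul_one] at this
  exact this.symm

/-- Unit vectors of fidelity `c` with a fixed one that are otherwise well separated. -/
theorem EuclideanSpace.exists_equiangular_packing {k N : ℕ} {c : ℝ} (h0 : 0 < c) (h1 : c ≤ 1 / 4)
    (hN : N * (4 * c) ^ k ≤ 1) :
    ∃ (v : EuclideanSpace ℂ (Fin (k + 2))) (w : Fin N → EuclideanSpace ℂ (Fin (k + 2))),
      ‖v‖ = 1 ∧ (∀ i, ‖w i‖ = 1) ∧ (∀ i, ‖(inner ℂ v (w i) : ℂ)‖ ^ 2 = c) ∧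
      ∀ i j, i ≠ j → ‖(inner ℂ (w i) (w j) : ℂ)‖ < 1 - 2 * c := by
  obtain ⟨χ, hχ, hsep⟩ := EuclideanSpace.exists_packing (by linarith) (by linarith) hN
  let w (i : Fin N) : EuclideanSpace ℂ (Fin (k + 2)) :=
    WithLp.toLp 2 (Fin.cons ((√c : ℝ) : ℂ) fun j => ((√(1 - c) : ℝ) : ℂ) * χ i j)
  have hs1 : ((√c : ℝ) : ℂ) * ((√c : ℝ) : ℂ) = c := by
    rw [← Complex.ofReal_mul, Real.mul_self_sqrt h0.le]
  have hs2 : ((√(1 - c) : ℝ) : ℂ) * ((√(1 - c) : ℝ) : ℂ) = 1 - c := by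
    rw [← Complex.ofReal_mul, Real.mul_self_sqrt (by linarith)]
    push_cast
    rfl
  have hin : ∀ i j, (inner ℂ (w i) (w j) : ℂ) = c + (1 - c) * inner ℂ (χ i) (χ j) := by
    intro i j
    rw [PiLp.inner_apply, PiLp.inner_apply, Fin.sum_univ_succ, Finset.mul_sum]
    congr 1
    · simpa only [w, Fin.cons_zero, RCLike.inner_apply, Complex.conj_ofReal] using hs1
    · refine Finset.sum_congr rfl fun l _ => ?_
      simp only [w, Fin.cons_succ, RCLike.inner_apply, map_mul, Complex.conj_ofReal]
      rw [← hs2]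
      ring
  refine ⟨EuclideanSpace.single 0 1, w, by simp, fun i => ?_, fun i => ?_, fun i j hij => ?_⟩
  · have h := hin i i
    rw [inner_self_eq_norm_sq_to_K, inner_self_eq_norm_sq_to_K, hχ] at h
    have h2 : ‖w i‖ ^ 2 = 1 := by
      have : ((‖w i‖ ^ 2 : ℝ) : ℂ) = 1 := by
        push_cast
        refine Eq.trans h ?_
        simp
      exact_mod_cast this
    nlinarith [norm_nonneg (w i)]
  · rw [EuclideanSpace.inner_single_left]
    simp [w, Real.sq_sqrt h0.le]
  · rw [hin]
    set z : ℂ := inner ℂ (χ i) (χ j) with hz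
    have hzs := hsep i j hij
    have hn := norm_nonneg z
    -- The packing radius `ε = 4c` suffices since `(1 - 3c)² - (1 - c)²(1 - 4c) = 4c³ > 0`.
    have h2 : (1 - c) * ‖z‖ < 1 - 3 * c := by
      refine lt_of_pow_lt_pow_left₀ 2 (by linarith) ?_
      have : (1 - c) ^ 2 * ‖z‖ ^ 2 ≤ (1 - c) ^ 2 * (1 - 4 * c) :=
        mul_le_mul_of_nonneg_left hzs.le (sq_nonneg _)
      have h3 : 0 < c ^ 3 := by positivity
      nlinarith
    calc ‖(c : ℂ) + (1 - c) * z‖ ≤ ‖(c : ℂ)‖ + ‖((1 - c : ℝ) : ℂ) * z‖ := by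
          push_cast
          exact norm_add_le _ _
      _ = c + (1 - c) * ‖z‖ := by
          rw [norm_mul, Complex.norm_real, Complex.norm_real, Real.norm_of_nonneg h0.le,
            Real.norm_of_nonneg (by linarith)]
      _ < 1 - 2 * c := by linarith

theorem tendsto_mul_div_rpow_atTop (a : ℝ) {s : ℝ} (hs : 0 < s) :
    Filter.Tendsto (fun n : ℕ => a / (n : ℝ) ^ s) Filter.atTop (nhds 0) :=
  ((tendsto_rpow_atTop hs).comp tendsto_natCast_atTop_atTop).const_div_atTop a

theorem mainTheorem8 (d : ℕ) (hd : 4 ≤ d) :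
    (∀ n : ℕ, 1 ≤ n →
      ∃ (ψ₀ : PureState d) (φ : Fin n → Fin d → PureState d),
        (∀ k i, φ k i ≠ ψ₀) ∧
        Function.Injective (fun x : Fin n × Fin d => φ x.1 x.2) ∧
        (∀ k, 0 < quantumOverlap
          ![Preparation.pure ψ₀, Preparation.uniform (show 0 < d by omega) (φ k)]) ∧
        ∀ O : OntologicalModel.{u} d,
          (1 / (n : ℝ)) * ∑ k,
              O.epistemicOverlap
                  ![Preparation.pure ψ₀, Preparation.uniform (show 0 < d by omega) (φ k)] /
                quantumOverlap
                  ![Preparation.pure ψ₀, Preparation.uniform (show 0 < d by omega) (φ k)]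
            ≤ 8 * (d : ℝ) ^ (1 / ((d : ℝ) - 2)) /
                (n : ℝ) ^ (((d : ℝ) - 3) / ((d : ℝ) - 2))) ∧
    Filter.Tendsto
      (fun n : ℕ => 8 * (d : ℝ) ^ (1 / ((d : ℝ) - 2)) /
        (n : ℝ) ^ (((d : ℝ) - 3) / ((d : ℝ) - 2)))
      Filter.atTop (nhds 0) := by
  have hdR : (4 : ℝ) ≤ d := by exact_mod_cast hd
  refine ⟨fun n hn => ?_, tendsto_mul_div_rpow_atTop _ (div_pos (by linarith) (by linarith))⟩
  have hnR : (1 : ℝ) ≤ n := by exact_mod_cast hn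
  have hn0 : (0 : ℝ) < n := by linarith
  have hd0 : (0 : ℝ) < d := by linarith
  set s : ℝ := 1 / ((d : ℝ) - 2) with hs
  have hs0 : 0 < s := one_div_pos.2 (by linarith)
  set R : ℝ := ((n * d : ℕ) : ℝ) ^ s with hR
  have hNR : (1 : ℝ) ≤ ((n * d : ℕ) : ℝ) := by
    exact_mod_cast Nat.mul_pos hn (by omega)
  have hR1 : 1 ≤ R := Real.one_le_rpow hNR hs0.le
  have hR0 : 0 < R := by linarith
  -- The largest fidelity the packing bound allows: `4c = R⁻¹` and `R ^ (d - 2) = nd` give `nd (4c)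
  -- ^ (d - 2) = 1`. Also `R ≥ 1` ensures `c ≤ 1/4`.
  set c : ℝ := 1 / (4 * R) with hc
  have hc0 : 0 < c := by positivity
  have hc4 : c ≤ 1 / 4 := by
    rw [hc]
    exact one_div_le_one_div_of_le (by norm_num) (by linarith)
  obtain ⟨v, w, hv, hw, hvw, hww⟩ : ∃ (v : EuclideanSpace ℂ (Fin d))
      (w : Fin (n * d) → EuclideanSpace ℂ (Fin d)), ‖v‖ = 1 ∧ (∀ i, ‖w i‖ = 1) ∧
      (∀ i, ‖(inner ℂ v (w i) : ℂ)‖ ^ 2 = c) ∧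
      ∀ i j, i ≠ j → ‖(inner ℂ (w i) (w j) : ℂ)‖ < 1 - 2 * c := by
    have hpow : ((n * d : ℕ) : ℝ) * (4 * c) ^ (d - 2) ≤ 1 := by
      have h4 : 4 * c = R⁻¹ := by rw [hc]; field_simp
      have hRd : R ^ (d - 2) = ((n * d : ℕ) : ℝ) := by
        rw [hR, ← Real.rpow_natCast, ← Real.rpow_mul (by linarith), Nat.cast_sub (by omega), hs]
        push_cast
        rw [one_div_mul_cancel (by linarith), Real.rpow_one]
      rw [h4, inv_pow, hRd, mul_inv_cancel₀ (by linarith)]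
    have hdk : d - 2 + 2 = d := by omega
    have := EuclideanSpace.exists_equiangular_packing hc0 hc4 hpow
    rwa [hdk] at this
  let ι : Fin n → Fin d → Fin (n * d) := fun k i => finProdFinEquiv (k, i)
  have hι : ∀ {k k' i i'}, ι k i = ι k' i' → k = k' ∧ i = i' := fun {k k' i i'} h => by
    simpa using finProdFinEquiv.injective h
  have hQ : ∀ k, c / 2 ≤ quantumOverlap ![Preparation.pure (PureState.ofVector v hv),
      Preparation.uniform (show 0 < d by omega)
        fun i => PureState.ofVector (w (ι k i)) (hw _)] := fun k =>
    le_quantumOverlap_pure_uniform (by omega) (by linarith) v hv (fun i => w (ι k i))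
      (fun i => hw _) fun i => hvw _
  refine ⟨PureState.ofVector v hv, fun k i => PureState.ofVector (w (ι k i)) (hw _),
    fun k i h => ?_, fun x y h => ?_, fun k => ?_, fun O => ?_⟩
  · have h1 := hvw (ι k i)
    rw [PureState.norm_inner_eq_one_of_ofVector_eq h] at h1
    linarith
  · by_contra hne
    have h1 := hww (ι y.1 y.2) (ι x.1 x.2) fun h => hne (Prod.ext (hι h).1.symm (hι h).2.symm)
    rw [PureState.norm_inner_eq_one_of_ofVector_eq h] at h1
    linarith
  · exact lt_of_lt_of_le (by linarith) (hQ k)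
  · have hE := O.sum_epistemicOverlap_le_one (show 0 < d by omega) (PureState.ofVector v hv)
      (fun k i => PureState.ofVector (w (ι k i)) (hw _)) (fun k k' hkk i i' => by
        obtain ⟨M, hM⟩ := POVM.exists_bornProb_eq_zero ![v, w (ι k i), w (ι k' i')]
          (by intro x; fin_cases x; exacts [hv, hw _, hw _]) (c := c) (hvw _).le (hvw _).le
          (hww _ _ fun h => hkk (hι h).1)
        refine ⟨M, fun x => ?_⟩
        have := hM x
        fin_cases x <;> exact this)
    have hsum : ∑ k, O.epistemicOverlap ![Preparation.pure (PureState.ofVector v hv),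
          Preparation.uniform (show 0 < d by omega)
            fun i => PureState.ofVector (w (ι k i)) (hw _)] /
        quantumOverlap ![Preparation.pure (PureState.ofVector v hv),
          Preparation.uniform (show 0 < d by omega)
            fun i => PureState.ofVector (w (ι k i)) (hw _)] ≤ 8 * R := by
      calc _ ≤ ∑ k, O.epistemicOverlap ![Preparation.pure (PureState.ofVector v hv),
          Preparation.uniform (show 0 < d by omega)
            fun i => PureState.ofVector (w (ι k i)) (hw _)] / (c / 2) :=
            Finset.sum_le_sum fun k _ =>
              div_le_div_of_nonneg_left ENNReal.toReal_nonneg (by linarith) (hQ k)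
        _ ≤ 1 / (c / 2) := by
            rw [← Finset.sum_div]
            exact div_le_div_of_nonneg_right hE (by linarith)
        _ = 8 * R := by rw [hc]; field_simp; norm_num
    refine (mul_le_mul_of_nonneg_left hsum (by positivity)).trans_eq ?_
    -- The bound is now `8R/n` with `R = (nd)^s`, so the power of `n` left in the denominator is `1
    -- - s`.
    have hexp : ((d : ℝ) - 3) / ((d : ℝ) - 2) = 1 - s := by
      rw [hs, eq_sub_iff_add_eq, ← add_div]
      rw [div_eq_one_iff_eq (by linarith)]
      ring
    rw [hexp, Real.rpow_sub hn0, Real.rpow_one, hR, Nat.cast_mul, Real.mul_rpow hn0.le hd0.le]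
    field_simp
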